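/- Let $d\ge 0$, $n\ge 1$, let $\lambda$ be Lebesgue measure on $\mathbb{R}^d$, let $\mu_1,\dots,\mu_n,\nu$ be Borel probability measures on $\mathbb{R}^d$ with $\mu_i\ll\lambda$ for all $i$, and put $\mu=\frac1n\sum_{i=1}^n\mu_i$. Let $\Pi(\overrightarrow{\mu},\nu)$ be the set of Borel probability measures $\pi$ on $\mathbb{R}^d\times\mathbb{R}^d$ with marginals $\mu$ and $\nu$ such that $$\int \pi^x(B)\,d\mu_i(x)=\nu(B)\qquad\text{for all } 1\le i\le n \text{ and all Borel } B\subset\mathbb{R}^d,$$ where $\pi^x$ are the conditional measures of $\pi$ given the first coordinate $x$. Let $\mathcal{T}(\overline{\mu},\nu)$ be the set of Borel maps $T:\mathbb{R}^d\to\mathbb{R}^d$ with $\mu_i\circ T^{-1}=\nu$ for all $i$. The Kantorovich problem is to minimize $\int\|x-y\|^2\,d\pi$ over $\pi\in\Pi(\overrightarrow{\mu},\nu)$, and the Monge problem is to minimize $\sum_{i=1}^n\int\|x-T(x)\|^2\,d\mu_i(x)$ over $T\in\mathcal{T}(\overline{\mu},\nu)$. Suppose that each density $\frac{d\mu_i}{d\mu}$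 has a version that is a simple function (Borel, with finitely many values) and is continuous at $\lambda$-almost every point of $\mathbb{R}^d$, and that some $\pi\in\Pi(\overrightarrow{\mu},\nu)$ has finite cost $\int\|x-y\|^2\,d\pi<\infty$. Then: 1. the Kantorovich problem has a solution; 2. every solution $\pi$ of the Kantorovich problem is concentrated on the graph of a Borel map $T$ that is a solution of the Monge problem; 3. the solution of the Kantorovich problem is unique; 4. the solution of the Monge problem is unique with respect to Lebesgue measure: any two solutions agree at $\lambda$-almost every point of $\{\frac{d\mu}{d\lambda}\neq 0\}$. -/

import Mathlib

open MeasureTheory ProbabilityTheory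
open scoped ENNReal NNReal

noncomputable section

namespace SimultaneousTransport

variable {X Y : Type*} [MeasurableSpace X] [MeasurableSpace Y]

/-- The averaged source measure `μ = (μ₁ + ⋯ + μₙ) / n`. -/
def meanMeasure {n : ℕ} (μs : Fin n → Measure X) : Measure X :=
  (n : ℝ≥0∞)⁻¹ • ∑ i, μs i

/-- The set `Π(μ⃗, ν)` of simultaneous transport plans: probability measures `π` on `X × Y` with
marginals `μ` (the mean of the `μᵢ`) and `ν`, whose conditional measures `π^x` satisfy
`∫ π^x(B) dμᵢ(x) = ν(B)` for all `i` and all measurable `B`. Here `π^x` is the regular conditional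
distribution (disintegration) of `π` along the first coordinate; it is determined up to a
`μ`-null set, hence up to a `μᵢ`-null set for each `i`. -/
def simultaneousPlans [StandardBorelSpace Y] [Nonempty Y] {n : ℕ}
    (μs : Fin n → Measure X) (ν : Measure Y) : Set (ProbabilityMeasure (X × Y)) :=
  {π | (π : Measure (X × Y)).fst = meanMeasure μs ∧
    (π : Measure (X × Y)).snd = ν ∧
    ∀ i, ∀ B, MeasurableSet B →
      ∫⁻ x, (π : Measure (X × Y)).condKernel x B ∂(μs i) = ν B}

/-- The total cost `∫ c dπ ∈ [0, ∞]` of a plan. -/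
def planCost (c : X → Y → ℝ≥0∞) (π : ProbabilityMeasure (X × Y)) : ℝ≥0∞ :=
  ∫⁻ p, c p.1 p.2 ∂(π : Measure (X × Y))

/-- `π` is a solution of the Kantorovich problem: it minimizes `∫ c dπ` over `Π(μ⃗, ν)`. -/
def IsKantorovichSolution [StandardBorelSpace Y] [Nonempty Y] {n : ℕ} (c : X → Y → ℝ≥0∞)
    (μs : Fin n → Measure X) (ν : Measure Y) (π : ProbabilityMeasure (X × Y)) : Prop :=
  π ∈ simultaneousPlans μs ν ∧ ∀ π' ∈ simultaneousPlans μs ν, planCost c π ≤ planCost c π'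

/-- The set `𝒯(μ̄, ν)` of measurable maps that push every `μᵢ` forward to `ν`. -/
def simultaneousMaps {n : ℕ} (μs : Fin n → Measure X) (ν : Measure Y) : Set (X → Y) :=
  {T | Measurable T ∧ ∀ i, (μs i).map T = ν}

/-- The Monge functional `∑ᵢ ∫ c(x, T x) dμᵢ(x) ∈ [0, ∞]`. -/
def mapCost {n : ℕ} (c : X → Y → ℝ≥0∞) (μs : Fin n → Measure X) (T : X → Y) : ℝ≥0∞ :=
  ∑ i, ∫⁻ x, c x (T x) ∂(μs i)

/-- `T` is a solution of the Monge problem: it minimizes the Monge functional over `𝒯(μ̄, ν)`. -/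
def IsMongeSolution {n : ℕ} (c : X → Y → ℝ≥0∞) (μs : Fin n → Measure X) (ν : Measure Y)
    (T : X → Y) : Prop :=
  T ∈ simultaneousMaps μs ν ∧ ∀ T' ∈ simultaneousMaps μs ν, mapCost c μs T ≤ mapCost c μs T'

/-- The quadratic cost `c(x, y) = ‖x - y‖²`. -/
def quadraticCost {E : Type*} [NormedAddCommGroup E] (x y : E) : ℝ≥0∞ :=
  ENNReal.ofReal (‖x - y‖ ^ 2)

/-- `π` is concentrated on the graph of `T`. -/
def ConcentratedOnGraph (π : ProbabilityMeasure (X × Y)) (T : X → Y) : Prop :=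
  (π : Measure (X × Y)) {p | p.2 = T p.1}ᶜ = 0

end SimultaneousTransport

end

/-!
The idea is to cut `ℝᵈ` along the level sets of the vector of densities `(dμ₁/dμ, …, dμₙ/dμ)`, of
which there are finitely many. In terms of the densities `wᵢ = dμᵢ/dμ` the constraint on a plan `π`
reads "the second marginal of `wᵢ(x) π(dx, dy)` is `ν`" (`mem_simultaneousPlans_iff`), which is
linear in `π` and is not affected by exchanging targets between sources with the same densities.

*Optimal plans are graphs.* Draw two independent pairs `(x, y)`, `(x', y')` from an optimal `π`. If
`x` and `x'` lie in the same level set and exchanging `y` and `y'` lowers the cost, replace `(x, y)`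
by `(x, y')`. The resulting law is again a simultaneous plan, strictly cheaper unless such
pairs form a null set (`IsKantorovichSolution.prod_improvable_eq_zero`). For the quadratic cost this
says that over each level set the support of `π` is a monotone subset of `ℝᵈ × ℝᵈ`. By the Lebesgue
density theorem, a monotone set has at most one point above Lebesgue-almost every `x`
(`ae_subsingleton_fiber_of_monotone`). Since `μ ≪ λ`, the conditional measures of `π` are Dirac
masses, so `π` is carried by the graph of a measurable map (`IsKantorovichSolution.exists_graph`).

*Existence.* Plans with fixed marginals are tight, so Prokhorov's theorem gives compactness once the
set of plans is closed. It is, since the densities are limits in `L¹(μ)` of bounded continuous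
functions and every plan has first marginal `μ` (`isCompact_simultaneousPlans`). The cost is lower
semicontinuous.

*Uniqueness.* The mean of two optimal plans is optimal, hence carried by a graph, which then carries
both (`IsKantorovichSolution.unique_of_forall_graph`). The Monge cost of `T` is `n` times the cost of
the plan `(id, T)_# μ`, so optimal maps correspond to optimal plans.
-/

/-! ### Monotone sets are graphs almost everywhere -/

section Monotone

open Metric Filter Topology
open scoped RealInnerProductSpace Pointwise

variable {E : Type*} [NormedAddCommGroup E] [InnerProductSpace ℝ E] [FiniteDimensional ℝ E]
  [MeasurableSpace E] [BorelSpace E]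

/-- A monotone set has at most one point above almost every `x`. If `y ≠ y'` lie above `x`, then at
almost every such `x` the points with a value near `y` have density one; one of them lies near
`x + r • (y' - y)` for some small `r > 0`, and this contradicts monotonicity against `(x, y')`. -/
theorem ae_subsingleton_fiber_of_monotone (ρ : Measure E) [ρ.IsAddHaarMeasure]
    {Γ : Set (E × E)} (hΓ : ∀ p ∈ Γ, ∀ q ∈ Γ, 0 ≤ ⟪p.1 - q.1, p.2 - q.2⟫) :
    ∀ᵐ x ∂ρ, {y | (x, y) ∈ Γ}.Subsingleton := by
  -- Countably many balls `B` suffice to isolate `y`; `A k m` is the set of points with a value in `B`.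
  let A : ℕ → ℕ → Set E := fun k m =>
    {x | ∃ y ∈ ball (TopologicalSpace.denseSeq E k) ((m + 1 : ℝ)⁻¹), (x, y) ∈ Γ}
  have hdens : ∀ᵐ x ∂ρ, ∀ k m, x ∈ A k m →
      Tendsto (fun r => ρ (A k m ∩ closedBall x r) / ρ (closedBall x r)) (𝓝[>] 0) (𝓝 1) := by
    simp only [ae_all_iff]
    exact fun k m => ae_imp_of_ae_restrict (Besicovitch.ae_tendsto_measure_inter_div ρ (A k m))
  filter_upwards [hdens] with x hx y hy y' hy'
  by_contra hne
  have hpos : 0 < ‖y' - y‖ := norm_pos_iff.2 (sub_ne_zero.2 (Ne.symm hne))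
  set v := y' - y with hv
  obtain ⟨m, hm⟩ := exists_nat_one_div_lt (show (0 : ℝ) < ‖v‖ / 8 by positivity)
  rw [one_div] at hm
  have hmpos : (0 : ℝ) < (m + 1 : ℝ)⁻¹ := by positivity
  obtain ⟨k, hk⟩ := (TopologicalSpace.denseRange_denseSeq E).exists_dist_lt y hmpos
  have hxA : x ∈ A k m := ⟨y, by simpa [mem_ball] using hk, hy⟩
  -- By density, `A k m` contains a point close to `x + r • v` for some small `r > 0`.
  have hnon := Measure.eventually_nonempty_inter_smul_of_density_one ρ (A k m) x (hx k m hxA)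
    (closedBall v (‖v‖ / 8)) measurableSet_closedBall
    (measure_closedBall_pos ρ v (by positivity)).ne'
  obtain ⟨r, ⟨z, ⟨w, hw, hwΓ⟩, hz⟩, (hr : 0 < r)⟩ := (hnon.and self_mem_nhdsWithin).exists
  obtain ⟨u, hu, rfl⟩ : ∃ u ∈ closedBall v (‖v‖ / 8), x + r • u = z := by
    rw [Set.singleton_add, Set.mem_image] at hz
    obtain ⟨_, ⟨u, hu, rfl⟩, h⟩ := hz
    exact ⟨u, hu, h⟩
  have hmono := hΓ _ hwΓ _ hy'
  simp only [add_sub_cancel_left, inner_smul_left, RCLike.conj_to_real] at hmono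
  have hmono' : 0 ≤ ⟪u, w - y'⟫ := nonneg_of_mul_nonneg_right hmono hr
  have h1 : ‖u - v‖ ≤ ‖v‖ / 8 := by simpa [dist_eq_norm] using hu
  have h2 : ‖w - y‖ ≤ ‖v‖ / 4 := by
    have h3 : dist w y ≤ dist w (TopologicalSpace.denseSeq E k)
        + dist y (TopologicalSpace.denseSeq E k) := dist_triangle_right _ _ _
    rw [mem_ball] at hw
    rw [dist_eq_norm] at h3
    linarith
  -- `⟪u, w - y'⟫` is a small perturbation of `⟪v, -v⟫ = -‖v‖ ^ 2`.
  have hdec : ⟪u, w - y'⟫ = ⟪u - v, w - y⟫ - ⟪u - v, v⟫ + ⟪v, w - y⟫ - ‖v‖ ^ 2 := by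
    have : w - y' = (w - y) - v := by rw [hv]; abel
    rw [this, ← real_inner_self_eq_norm_sq]
    simp only [inner_sub_left, inner_sub_right]
    ring
  have b1 := real_inner_le_norm (u - v) (w - y)
  have b2 := neg_le_of_abs_le (abs_real_inner_le_norm (u - v) v)
  have b3 := real_inner_le_norm v (w - y)
  have c1 : ‖u - v‖ * ‖w - y‖ ≤ (‖v‖ / 8) * (‖v‖ / 4) := by gcongr
  have c2 : ‖u - v‖ * ‖v‖ ≤ (‖v‖ / 8) * ‖v‖ := by gcongr
  have c3 : ‖v‖ * ‖w - y‖ ≤ ‖v‖ * (‖v‖ / 4) := by gcongr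
  nlinarith [mul_pos hpos hpos]

end Monotone

namespace SimultaneousTransport

/-! ### Swapping the targets of two independent pairs -/

section Swap

variable {X Y : Type*} [MeasurableSpace X] [MeasurableSpace Y]

open Classical in
/-- The law of `(x, y')` on `S` and of `(x, y)` off `S`, where `(x, y)` and `(x', y')` are
independent with law `π`. -/
noncomputable def swapMeasure (π : Measure (X × Y)) (S : Set ((X × Y) × (X × Y))) : Measure (X × Y) :=
  (π.prod π).map (fun q => if q ∈ S then (q.1.1, q.2.2) else q.1)

open Classical in
theorem measurable_swapMap {S : Set ((X × Y) × (X × Y))} (hS : MeasurableSet S) :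
    Measurable (fun q : (X × Y) × (X × Y) => if q ∈ S then (q.1.1, q.2.2) else q.1) :=
  Measurable.ite hS (by fun_prop) (by fun_prop)

variable {π : Measure (X × Y)} {S : Set ((X × Y) × (X × Y))}


theorem lintegral_swapMeasure (hS : MeasurableSet S) {h : X × Y → ℝ≥0∞} (hh : Measurable h) :
    ∫⁻ p, h p ∂(swapMeasure π S) =
      ∫⁻ q in S, h (q.1.1, q.2.2) ∂(π.prod π) + ∫⁻ q in Sᶜ, h q.1 ∂(π.prod π) := by
  classical
  rw [swapMeasure, lintegral_map hh (measurable_swapMap hS), ← lintegral_add_compl _ hS]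
  congr 1
  · exact setLIntegral_congr_fun hS fun q hq => by simp [hq]
  · exact setLIntegral_congr_fun hS.compl fun q hq => by
      have : q ∉ S := hq
      simp [this]

variable [IsProbabilityMeasure π]

theorem isProbabilityMeasure_swapMeasure (hS : MeasurableSet S) :
    IsProbabilityMeasure (swapMeasure π S) :=
  Measure.isProbabilityMeasure_map (measurable_swapMap hS).aemeasurable

theorem lintegral_eq_setLIntegral_add_compl (hS : MeasurableSet S) {h : X × Y → ℝ≥0∞}
    (hh : Measurable h) :
    ∫⁻ p, h p ∂π = ∫⁻ q in S, h q.1 ∂(π.prod π) + ∫⁻ q in Sᶜ, h q.1 ∂(π.prod π) := by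
  rw [lintegral_add_compl _ hS, ← lintegral_map hh measurable_fst]
  simp

theorem setLIntegral_comp_swap (hS : MeasurableSet S) (hsymm : ∀ q, q.swap ∈ S ↔ q ∈ S)
    {h : (X × Y) × (X × Y) → ℝ≥0∞} (hh : Measurable h) :
    ∫⁻ q in S, h q.swap ∂(π.prod π) = ∫⁻ q in S, h q ∂(π.prod π) := by
  have key := Measure.measurePreserving_swap (μ := π) (ν := π)
  have hpre : Prod.swap ⁻¹' S = S := Set.ext hsymm
  conv_lhs => rw [← hpre]
  exact key.setLIntegral_comp_preimage hS hh

/-- Swapping preserves the integral of any `h` with `h (x, y') = h (x, y)` on `S`. -/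
theorem lintegral_swapMeasure_of_eq_fst (hS : MeasurableSet S) {h : X × Y → ℝ≥0∞}
    (hh : Measurable h) (heq : ∀ q ∈ S, h (q.1.1, q.2.2) = h q.1) :
    ∫⁻ p, h p ∂(swapMeasure π S) = ∫⁻ p, h p ∂π := by
  rw [lintegral_swapMeasure hS hh, lintegral_eq_setLIntegral_add_compl hS hh,
    setLIntegral_congr_fun hS heq]

/-- Swapping preserves the integral of any `h` with `h (x, y') = h (x', y')` on `S`. -/
theorem lintegral_swapMeasure_of_eq_snd (hS : MeasurableSet S)
    (hsymm : ∀ q, q.swap ∈ S ↔ q ∈ S) {h : X × Y → ℝ≥0∞}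
    (hh : Measurable h) (heq : ∀ q ∈ S, h (q.1.1, q.2.2) = h q.2) :
    ∫⁻ p, h p ∂(swapMeasure π S) = ∫⁻ p, h p ∂π := by
  rw [lintegral_swapMeasure hS hh, lintegral_eq_setLIntegral_add_compl hS hh,
    setLIntegral_congr_fun hS heq]
  congr 1
  exact setLIntegral_comp_swap hS hsymm (hh.comp measurable_fst)

/-- If swapping strictly decreases the total cost of each pair in `S` and yet does not decrease
the total cost of `π`, then `S` is null. -/
theorem prod_eq_zero_of_lintegral_le_swapMeasure (hS : MeasurableSet S)
    (hsymm : ∀ q, q.swap ∈ S ↔ q ∈ S) {h : X × Y → ℝ≥0∞} (hh : Measurable h)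
    (hfin : ∫⁻ p, h p ∂π ≠ ∞)
    (hlt : ∀ q ∈ S, h (q.1.1, q.2.2) + h (q.2.1, q.1.2) < h q.1 + h q.2)
    (hle : ∫⁻ p, h p ∂π ≤ ∫⁻ p, h p ∂(swapMeasure π S)) :
    (π.prod π) S = 0 := by
  have hsplit := lintegral_eq_setLIntegral_add_compl (π := π) hS hh
  rw [lintegral_swapMeasure hS hh, hsplit] at hle
  rw [hsplit, ENNReal.add_ne_top] at hfin
  have hle' := (ENNReal.add_le_add_iff_right hfin.2).1 hle
  -- By symmetry of `S`, integrating the cost of both pairs doubles both sides of `hle'`.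
  have hswap1 : ∫⁻ q in S, h q.2 ∂(π.prod π) = ∫⁻ q in S, h q.1 ∂(π.prod π) :=
    setLIntegral_comp_swap hS hsymm (hh.comp measurable_fst)
  have hswap2 : ∫⁻ q in S, h (q.2.1, q.1.2) ∂(π.prod π)
      = ∫⁻ q in S, h (q.1.1, q.2.2) ∂(π.prod π) :=
    setLIntegral_comp_swap (h := fun q => h (q.1.1, q.2.2)) hS hsymm (by fun_prop)
  by_contra hne
  have hdouble : ∫⁻ q in S, (h q.1 + h q.2) ∂(π.prod π)
      ≤ ∫⁻ q in S, (h (q.1.1, q.2.2) + h (q.2.1, q.1.2)) ∂(π.prod π) := by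
    rw [lintegral_add_left (by fun_prop), lintegral_add_left (by fun_prop), hswap1, hswap2]
    gcongr
  have hfin' : ∫⁻ q in S, (h q.1 + h q.2) ∂(π.prod π) ≠ ∞ := by
    rw [lintegral_add_left (by fun_prop), hswap1]
    exact ENNReal.add_ne_top.2 ⟨hfin.1, hfin.1⟩
  refine hdouble.not_gt (setLIntegral_strict_mono hS hne (by fun_prop) ?_ ?_)
  · exact ne_top_of_le_ne_top hfin' (setLIntegral_mono (by fun_prop) fun q hq => (hlt q hq).le)
  · exact Filter.Eventually.of_forall hlt

end Swap

/-! ### Plans in terms of densities -/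

section Plans

variable {X Y : Type*} [MeasurableSpace X] [MeasurableSpace Y] {n : ℕ}

theorem isProbabilityMeasure_meanMeasure (hn : 0 < n) (μs : Fin n → Measure X)
    [∀ i, IsProbabilityMeasure (μs i)] : IsProbabilityMeasure (meanMeasure μs) := by
  constructor
  have hn' : (n : ℝ≥0∞) ≠ 0 := by exact_mod_cast hn.ne'
  simp [meanMeasure, ENNReal.inv_mul_cancel hn' (ENNReal.natCast_ne_top n)]

theorem natCast_smul_meanMeasure (hn : 0 < n) (μs : Fin n → Measure X) :
    (n : ℝ≥0∞) • meanMeasure μs = ∑ i, μs i := by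
  have hn' : (n : ℝ≥0∞) ≠ 0 := by exact_mod_cast hn.ne'
  rw [meanMeasure, smul_smul, ENNReal.mul_inv_cancel hn' (ENNReal.natCast_ne_top n), one_smul]

theorem absolutelyContinuous_meanMeasure (hn : 0 < n) (μs : Fin n → Measure X) (i : Fin n) :
    μs i ≪ meanMeasure μs := by
  have h : μs i ≪ (n : ℝ≥0∞) • meanMeasure μs := by
    rw [natCast_smul_meanMeasure hn]
    refine Measure.absolutelyContinuous_of_le (Measure.le_intro fun s _ _ => ?_)
    rw [Measure.finsetSum_apply]
    exact Finset.single_le_sum (f := fun j => μs j s) (fun _ _ => zero_le) (Finset.mem_univ i)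
  exact h.trans (Measure.smul_absolutelyContinuous)

theorem meanMeasure_absolutelyContinuous {μs : Fin n → Measure X} {ρ : Measure X}
    (hac : ∀ i, μs i ≪ ρ) : meanMeasure μs ≪ ρ := by
  refine Measure.AbsolutelyContinuous.mk fun s _ hs => ?_
  simp [meanMeasure, Measure.finsetSum_apply, fun i => hac i hs]

theorem withDensity_meanMeasure_eq (hn : 0 < n) {μs : Fin n → Measure X}
    [∀ i, IsProbabilityMeasure (μs i)] {w : X → ℝ≥0∞} {i : Fin n}
    (hw : w =ᵐ[meanMeasure μs] (μs i).rnDeriv (meanMeasure μs)) :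
    (meanMeasure μs).withDensity w = μs i := by
  have := isProbabilityMeasure_meanMeasure hn μs
  rw [withDensity_congr_ae hw,
    Measure.withDensity_rnDeriv_eq _ _ (absolutelyContinuous_meanMeasure hn μs i)]

theorem snd_withDensity_apply (π : Measure (X × Y)) {w : X → ℝ≥0∞}
    {B : Set Y} (hB : MeasurableSet B) :
    (π.withDensity fun p => w p.1).snd B = ∫⁻ p, w p.1 * B.indicator 1 p.2 ∂π := by
  rw [Measure.snd_apply hB, withDensity_apply _ (measurable_snd hB),
    ← lintegral_indicator (measurable_snd hB)]
  refine lintegral_congr fun p => ?_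
  by_cases h : p.2 ∈ B <;> simp [h]

theorem snd_withDensity_map_graph {μ : Measure X} {T : X → Y} (hT : Measurable T)
    {w : X → ℝ≥0∞} (hw : Measurable w) :
    ((μ.map fun x => (x, T x)).withDensity fun p => w p.1).snd = (μ.withDensity w).map T := by
  ext B hB
  have hm : Measurable fun p : X × Y => w p.1 * B.indicator 1 p.2 :=
    (hw.comp measurable_fst).mul ((measurable_one.indicator hB).comp measurable_snd)
  rw [snd_withDensity_apply _ hB, lintegral_map hm (by fun_prop),
    Measure.map_apply hT hB, withDensity_apply _ (hT hB), ← lintegral_indicator (hT hB)]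
  refine lintegral_congr fun x => ?_
  by_cases h : T x ∈ B <;> simp [h]

/-- Disintegration turns the average of the conditional measures against the density `w` into a
second marginal of a measure with density on the product. -/
theorem lintegral_condKernel_withDensity [StandardBorelSpace Y] [Nonempty Y]
    (π : Measure (X × Y)) [IsFiniteMeasure π] {w : X → ℝ≥0∞} (hw : Measurable w)
    {B : Set Y} (hB : MeasurableSet B) :
    ∫⁻ x, π.condKernel x B ∂(π.fst.withDensity w) = (π.withDensity fun p => w p.1).snd B := by
  rw [snd_withDensity_apply π hB,
    lintegral_withDensity_eq_lintegral_mul _ hw (π.condKernel.measurable_coe hB)]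
  have hm : Measurable fun p : X × Y => w p.1 * B.indicator 1 p.2 :=
    (hw.comp measurable_fst).mul ((measurable_one.indicator hB).comp measurable_snd)
  conv_rhs => rw [← π.disintegrate π.condKernel, Measure.lintegral_compProd hm]
  refine lintegral_congr fun x => ?_
  change w x * π.condKernel x B = ∫⁻ y, w x * B.indicator 1 y ∂π.condKernel x
  rw [lintegral_const_mul _ (measurable_one.indicator hB), lintegral_indicator_one hB]

variable [StandardBorelSpace Y] [Nonempty Y] {μs : Fin n → Measure X}
  [∀ i, IsProbabilityMeasure (μs i)] {ν : Measure Y} {w : Fin n → X → ℝ≥0∞}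

/-- In terms of the densities `w i` of `μᵢ` with respect to `μ`, the constraint on the conditional
measures says that the second marginal of `w i(x) π(dx, dy)` is `ν`, which is linear in `π`. -/
theorem mem_simultaneousPlans_iff (hn : 0 < n) (hwm : ∀ i, Measurable (w i))
    (hw : ∀ i, w i =ᵐ[meanMeasure μs] (μs i).rnDeriv (meanMeasure μs))
    {π : ProbabilityMeasure (X × Y)} :
    π ∈ simultaneousPlans μs ν ↔ (π : Measure (X × Y)).fst = meanMeasure μs ∧
      (π : Measure (X × Y)).snd = ν ∧
      ∀ i, ((π : Measure (X × Y)).withDensity fun p => w i p.1).snd = ν := by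
  refine and_congr_right fun hfst => and_congr_right fun _ => forall_congr' fun i => ?_
  have key : ∀ B, MeasurableSet B → ∫⁻ x, (π : Measure (X × Y)).condKernel x B ∂(μs i) =
      ((π : Measure (X × Y)).withDensity fun p => w i p.1).snd B := fun B hB => by
    rw [← lintegral_condKernel_withDensity _ (hwm i) hB, hfst, withDensity_meanMeasure_eq hn (hw i)]
  exact ⟨fun h => Measure.ext fun B hB => (key B hB).symm.trans (h B hB),
    fun h B hB => (key B hB).trans (by rw [h])⟩

/-- Two independent pairs drawn from an optimal plan, whose sources have the same densities
`w i`, almost surely cannot be improved by swapping their targets. -/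
theorem IsKantorovichSolution.prod_improvable_eq_zero (hn : 0 < n)
    (hwm : ∀ i, Measurable (w i))
    (hw : ∀ i, w i =ᵐ[meanMeasure μs] (μs i).rnDeriv (meanMeasure μs))
    {c : X → Y → ℝ≥0∞} (hc : Measurable fun p : X × Y => c p.1 p.2)
    {π : ProbabilityMeasure (X × Y)} (hπ : IsKantorovichSolution c μs ν π)
    (hfin : planCost c π ≠ ∞) :
    (π : Measure (X × Y)).prod (π : Measure (X × Y))
      {q | (∀ i, w i q.1.1 = w i q.2.1) ∧
        c q.1.1 q.2.2 + c q.2.1 q.1.2 < c q.1.1 q.1.2 + c q.2.1 q.2.2} = 0 := by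
  set S : Set ((X × Y) × (X × Y)) := {q | (∀ i, w i q.1.1 = w i q.2.1) ∧
    c q.1.1 q.2.2 + c q.2.1 q.1.2 < c q.1.1 q.1.2 + c q.2.1 q.2.2} with hSdef
  have hS : MeasurableSet S := by
    rw [hSdef, Set.ofPred_and, Set.ofPred_forall]
    refine MeasurableSet.inter ?_ ?_
    · exact MeasurableSet.iInter fun i => measurableSet_eq_fun
        ((hwm i).comp (measurable_fst.comp measurable_fst))
        ((hwm i).comp (measurable_fst.comp measurable_snd))
    · exact measurableSet_lt
        ((hc.comp ((measurable_fst.comp measurable_fst).prodMk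
          (measurable_snd.comp measurable_snd))).add
          (hc.comp ((measurable_fst.comp measurable_snd).prodMk
          (measurable_snd.comp measurable_fst))))
        ((hc.comp measurable_fst).add (hc.comp measurable_snd))
  have hsymm : ∀ q, q.swap ∈ S ↔ q ∈ S := fun q => by
    simp only [hSdef, Set.mem_ofPred_eq, Prod.fst_swap, Prod.snd_swap]
    refine and_congr (forall_congr' fun i => eq_comm) ?_
    rw [add_comm (c q.2.1 q.1.2), add_comm (c q.2.1 q.2.2)]
  have hprob := isProbabilityMeasure_swapMeasure (π := (π : Measure (X × Y))) hS
  let π' : ProbabilityMeasure (X × Y) := ⟨swapMeasure (π : Measure (X × Y)) S, hprob⟩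
  obtain ⟨hfst, hsnd, hdens⟩ := (mem_simultaneousPlans_iff hn hwm hw).1 hπ.1
  have hπ' : π' ∈ simultaneousPlans μs ν := by
    refine (mem_simultaneousPlans_iff hn hwm hw).2 ⟨?_, ?_, fun i => ?_⟩
    · rw [← hfst]
      ext B hB
      rw [Measure.fst_apply hB, Measure.fst_apply hB, ← lintegral_indicator_one (measurable_fst hB),
        ← lintegral_indicator_one (measurable_fst hB)]
      exact lintegral_swapMeasure_of_eq_fst hS (measurable_one.indicator (measurable_fst hB))
        fun q _ => rfl
    · rw [← hsnd]
      ext B hB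
      rw [Measure.snd_apply hB, Measure.snd_apply hB, ← lintegral_indicator_one (measurable_snd hB),
        ← lintegral_indicator_one (measurable_snd hB)]
      exact lintegral_swapMeasure_of_eq_snd hS hsymm (measurable_one.indicator (measurable_snd hB))
        fun q _ => rfl
    · rw [← hdens i]
      ext B hB
      rw [snd_withDensity_apply _ hB, snd_withDensity_apply _ hB]
      exact lintegral_swapMeasure_of_eq_snd hS hsymm
        (((hwm i).comp measurable_fst).mul ((measurable_one.indicator hB).comp measurable_snd))
        fun q hq => by simp only [hq.1 i]
  exact prod_eq_zero_of_lintegral_le_swapMeasure hS hsymm hc hfin (fun q hq => hq.2)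
    (hπ.2 π' hπ')

end Plans

/-! ### Optimal plans are carried by graphs -/

section Graph

open scoped RealInnerProductSpace

/-- A measure carried by a set with almost everywhere at most one point in each fibre is carried by
the graph of a measurable map, namely of the barycentre of its conditional measures. -/
theorem exists_measurable_graph {X E : Type*} [MeasurableSpace X] [NormedAddCommGroup E]
    [NormedSpace ℝ E] [CompleteSpace E] [SecondCountableTopology E] [MeasurableSpace E]
    [BorelSpace E] (π : Measure (X × E)) [IsProbabilityMeasure π] {Γ : Set (X × E)}
    (hπ : ∀ᵐ p ∂π, p ∈ Γ) (hΓ : ∀ᵐ x ∂π.fst, {y | (x, y) ∈ Γ}.Subsingleton) :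
    ∃ T : X → E, Measurable T ∧ ∀ᵐ p ∂π, p.2 = T p.1 := by
  have hT : Measurable fun x => ∫ y, y ∂(π.condKernel x) :=
    (stronglyMeasurable_id.integral_kernel (κ := π.condKernel)).measurable
  refine ⟨_, hT, ?_⟩
  have hmeas : MeasurableSet {p : X × E | p.2 = ∫ y, y ∂(π.condKernel p.1)} :=
    measurableSet_eq_fun measurable_snd (hT.comp measurable_fst)
  have hdis : π.fst ⊗ₘ π.condKernel = π := π.disintegrate π.condKernel
  rw [← hdis] at hπ
  have h := Measure.ae_ae_of_ae_compProd hπ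
  have key : ∀ᵐ p ∂(π.fst ⊗ₘ π.condKernel), p.2 = ∫ y, y ∂(π.condKernel p.1) := by
    rw [Measure.ae_compProd_iff hmeas]
    filter_upwards [h, hΓ] with x hx hsub
    obtain ⟨y₀, hy₀⟩ := hx.exists
    have hae : ∀ᵐ y ∂(π.condKernel x), y = y₀ := hx.mono fun y hy => hsub hy hy₀
    have hint : ∫ y, y ∂(π.condKernel x) = y₀ := by
      rw [integral_congr_ae hae]
      simp
    filter_upwards [hae] with y hy
    simp only [hint, hy]
  rwa [hdis] at key

theorem measurable_quadraticCost {E : Type*} [NormedAddCommGroup E] [MeasurableSpace E]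
    [BorelSpace E] [SecondCountableTopology E] :
    Measurable fun p : E × E => quadraticCost p.1 p.2 := by
  unfold quadraticCost
  fun_prop

variable {E : Type*} [NormedAddCommGroup E] [InnerProductSpace ℝ E]

theorem quadraticCost_swap_lt_iff (x y x' y' : E) :
    quadraticCost x y' + quadraticCost x' y < quadraticCost x y + quadraticCost x' y' ↔
      ⟪x - x', y - y'⟫ < 0 := by
  simp only [quadraticCost]
  rw [← ENNReal.ofReal_add (by positivity) (by positivity),
    ← ENNReal.ofReal_add (by positivity) (by positivity),
    ENNReal.ofReal_lt_ofReal_iff_of_nonneg (by positivity)]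
  simp only [norm_sub_sq_real, inner_sub_left, inner_sub_right]
  constructor <;> intro h <;> linarith

variable [MeasurableSpace E] [BorelSpace E]

/-- If the independent pairs drawn from `π` with sources in `A` are almost surely in monotone
position, then the support of the restriction of `π` to `A × E` is a monotone set, because the
pairs in the wrong position form an open set. -/
theorem inner_nonneg_of_mem_support_restrict [SecondCountableTopology E] {π : Measure (E × E)}
      [IsProbabilityMeasure π] {A : Set E}
    (h : π.prod π {q | q.1.1 ∈ A ∧ q.2.1 ∈ A ∧ ⟪q.1.1 - q.2.1, q.1.2 - q.2.2⟫ < 0} = 0)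
    {p q : E × E} (hp : p ∈ (π.restrict (Prod.fst ⁻¹' A)).support)
    (hq : q ∈ (π.restrict (Prod.fst ⁻¹' A)).support) :
    0 ≤ ⟪p.1 - q.1, p.2 - q.2⟫ := by
  by_contra! hlt
  have hopen : IsOpen {r : (E × E) × (E × E) | ⟪r.1.1 - r.2.1, r.1.2 - r.2.2⟫ < 0} :=
    isOpen_lt (by fun_prop) continuous_const
  obtain ⟨U, V, hU, hV, hpU, hqV, hUV⟩ := isOpen_prod_iff.1 hopen p q hlt
  rw [Measure.support_eq_forall_isOpen] at hp hq
  have hU' := hp U hpU hU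
  have hV' := hq V hqV hV
  rw [Measure.restrict_apply hU.measurableSet] at hU'
  rw [Measure.restrict_apply hV.measurableSet] at hV'
  refine (ENNReal.mul_pos hU'.ne' hV'.ne').ne' ?_
  rw [← Measure.prod_prod]
  refine measure_mono_null ?_ h
  rintro ⟨r, s⟩ ⟨⟨hrU, hrA⟩, hsV, hsA⟩
  exact ⟨hrA, hsA, hUV ⟨hrU, hsV⟩⟩

variable [FiniteDimensional ℝ E] {n : ℕ} {μs : Fin n → Measure E}
  [∀ i, IsProbabilityMeasure (μs i)] {ν : Measure E} {f : Fin n → SimpleFunc E ℝ≥0}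

/-- On a set where the densities are constant, no pair of points of an optimal plan can be improved
by a swap, so the corresponding piece of the plan has a monotone support. -/
theorem IsKantorovichSolution.inner_nonneg_of_mem_support (hn : 0 < n)
    (hf : ∀ i, (fun x => (f i x : ℝ≥0∞)) =ᵐ[meanMeasure μs] (μs i).rnDeriv (meanMeasure μs))
    {π : ProbabilityMeasure (E × E)} (hπ : IsKantorovichSolution quadraticCost μs ν π)
    (hfin : planCost quadraticCost π ≠ ∞) {A : Set E}
    (hA : ∀ x ∈ A, ∀ x' ∈ A, ∀ i, f i x = f i x')
    {p q : E × E} (hp : p ∈ ((π : Measure (E × E)).restrict (Prod.fst ⁻¹' A)).support)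
    (hq : q ∈ ((π : Measure (E × E)).restrict (Prod.fst ⁻¹' A)).support) :
    0 ≤ ⟪p.1 - q.1, p.2 - q.2⟫ := by
  have hswap := hπ.prod_improvable_eq_zero hn (w := fun i x => (f i x : ℝ≥0∞))
    (fun i => (f i).measurable.coe_nnreal_ennreal) hf measurable_quadraticCost hfin
  refine inner_nonneg_of_mem_support_restrict (measure_mono_null ?_ hswap) hp hq
  intro r hr
  rw [Set.mem_ofPred_eq] at hr ⊢
  exact ⟨fun i => by rw [hA _ hr.1 _ hr.2.1 i], (quadraticCost_swap_lt_iff _ _ _ _).2 hr.2.2⟩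

/-- The level sets of the densities cut an optimal plan into finitely many pieces with monotone
supports, each of which is a graph above almost every point. -/
theorem IsKantorovichSolution.exists_graph (hn : 0 < n) {ρ : Measure E} [ρ.IsAddHaarMeasure]
    (hac : ∀ i, μs i ≪ ρ)
    (hf : ∀ i, (fun x => (f i x : ℝ≥0∞)) =ᵐ[meanMeasure μs] (μs i).rnDeriv (meanMeasure μs))
    {π : ProbabilityMeasure (E × E)} (hπ : IsKantorovichSolution quadraticCost μs ν π)
    (hfin : planCost quadraticCost π ≠ ∞) :
    ∃ T : E → E, Measurable T ∧ ∀ᵐ p ∂(π : Measure (E × E)), p.2 = T p.1 := by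
  -- `F` is the vector of densities and `Γ v` the support of the piece of `π` over `{F = v}`.
  obtain ⟨F, hF⟩ : ∃ F : E → Fin n → ℝ≥0, ∀ x i, F x i = f i x := ⟨fun x i => f i x, fun _ _ => rfl⟩
  have hFfin : (Set.range F).Countable := by
    refine (Set.Finite.subset (Set.Finite.pi' fun i => (f i).finite_range) ?_).countable
    rintro _ ⟨x, rfl⟩ i
    exact ⟨x, (hF x i).symm⟩
  obtain ⟨Γ, hΓ⟩ : ∃ Γ : (Fin n → ℝ≥0) → Set (E × E), ∀ v, Γ v =
      ((π : Measure (E × E)).restrict (Prod.fst ⁻¹' (F ⁻¹' {v}))).support := ⟨_, fun _ => rfl⟩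
  have hmono : ∀ v, ∀ p ∈ Γ v, ∀ q ∈ Γ v, 0 ≤ ⟪p.1 - q.1, p.2 - q.2⟫ := by
    intro v p hp q hq
    rw [hΓ] at hp hq
    refine hπ.inner_nonneg_of_mem_support hn hf hfin (fun x hx x' hx' i => ?_) hp hq
    rw [Set.mem_preimage, Set.mem_singleton_iff] at hx hx'
    rw [← hF, ← hF, hx, hx']
  refine exists_measurable_graph (π : Measure (E × E)) (Γ := {p | p ∈ Γ (F p.1)}) ?_ ?_
  · have hv : ∀ v ∈ Set.range F, ∀ᵐ p ∂(π : Measure (E × E)),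
        p ∈ Prod.fst ⁻¹' (F ⁻¹' {v}) → p ∈ Γ v := fun v _ => by
      rw [hΓ]
      exact ae_imp_of_ae_restrict Measure.support_mem_ae
    filter_upwards [(ae_ball_iff hFfin).2 hv] with p hp
    exact hp _ ⟨p.1, rfl⟩ rfl
  · have hle : (π : Measure (E × E)).fst ≪ ρ := by
      rw [hπ.1.1]
      exact meanMeasure_absolutelyContinuous hac
    have hs : ∀ v ∈ Set.range F, ∀ᵐ x ∂ρ, {y | (x, y) ∈ Γ v}.Subsingleton :=
      fun v _ => ae_subsingleton_fiber_of_monotone ρ (hmono v)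
    refine hle.ae_le ?_
    filter_upwards [(ae_ball_iff hFfin).2 hs] with x hx
    exact hx _ ⟨x, rfl⟩

end Graph

/-! ### Existence of optimal plans -/

section Existence

open Topology BoundedContinuousFunction

/-- The integral of an unbounded continuous function is the supremum of the integrals of its
truncations, which are continuous for weak convergence. -/
theorem lowerSemicontinuous_lintegral_nnreal {Z : Type*} [TopologicalSpace Z] [MeasurableSpace Z]
    [OpensMeasurableSpace Z] {h : Z → ℝ≥0} (hh : Continuous h) :
    LowerSemicontinuous fun π : ProbabilityMeasure Z => ∫⁻ z, h z ∂(π : Measure Z) := by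
  let t : ℕ → Z →ᵇ ℝ≥0 := fun N => BoundedContinuousFunction.mkOfBound
    ⟨fun z => min (h z) N, by fun_prop⟩ N fun x y => by
      simp only [ContinuousMap.coe_mk, NNReal.dist_eq, NNReal.coe_min]
      have h1 : (0 : ℝ) ≤ min (h x : ℝ) N := by positivity
      have h2 : (0 : ℝ) ≤ min (h y : ℝ) N := by positivity
      have h3 : min (h x : ℝ) N ≤ N := min_le_right _ _
      have h4 : min (h y : ℝ) N ≤ N := min_le_right _ _
      rw [abs_le]
      constructor <;> push_cast <;> linarith
  have ht : ∀ N z, t N z = min (h z) N := fun _ _ => rfl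
  have hsup : ∀ π : ProbabilityMeasure Z,
      ∫⁻ z, h z ∂(π : Measure Z) = ⨆ N, ∫⁻ z, t N z ∂(π : Measure Z) := fun π => by
    rw [← lintegral_iSup (fun N => by fun_prop)]
    · refine lintegral_congr fun z => le_antisymm ?_ (iSup_le fun N => ?_)
      · obtain ⟨N, hN⟩ := exists_nat_ge (h z)
        refine le_iSup_of_le N ?_
        rw [ht, min_eq_left hN]
      · rw [ht]
        exact_mod_cast min_le_left _ _
    · intro N M hNM z
      simp only [ht]
      gcongr
  simp only [hsup]
  exact lowerSemicontinuous_iSup fun N =>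
    (ProbabilityMeasure.continuous_lintegral_boundedContinuousFunction (t N)).lowerSemicontinuous

theorem integral_snd_withDensity {X Y : Type*} [MeasurableSpace X] [TopologicalSpace Y]
    [MeasurableSpace Y] [OpensMeasurableSpace Y] (π : Measure (X × Y)) {w : X → ℝ≥0}
    (hw : Measurable w) (ψ : Y →ᵇ ℝ) :
    ∫ y, ψ y ∂(π.withDensity fun p => (w p.1 : ℝ≥0∞)).snd = ∫ p, (w p.1 : ℝ) * ψ p.2 ∂π := by
  rw [Measure.snd, integral_map measurable_snd.aemeasurable
    ψ.continuous.measurable.aestronglyMeasurable,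
    integral_withDensity_eq_integral_smul (f := fun p : X × Y => w p.1) (hw.comp measurable_fst)]
  rfl

variable {X Y : Type*} [TopologicalSpace X] [TopologicalSpace Y]
  [MeasurableSpace X] [MeasurableSpace Y]

/-- With the first marginal fixed, a merely integrable `w` may be tested against: it is a limit in
`L¹(μ)` of bounded continuous functions, uniformly over the plans. -/
theorem continuousOn_integral_mul [NormalSpace X] [BorelSpace X] [OpensMeasurableSpace Y]
    [OpensMeasurableSpace (X × Y)]
    {μ : Measure X} [IsFiniteMeasure μ] [μ.WeaklyRegular]
    {w : X → ℝ} (hw : Integrable w μ) (ψ : Y →ᵇ ℝ) :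
    ContinuousOn (fun π : ProbabilityMeasure (X × Y) => ∫ p, w p.1 * ψ p.2 ∂(π : Measure (X × Y)))
      {π | (π : Measure (X × Y)).fst = μ} := by
  refine continuousOn_of_uniform_approx_of_continuousOn fun u hu => ?_
  obtain ⟨ε, hε, hu⟩ := Metric.mem_uniformity_dist.1 hu
  have hδ : 0 < ε / (2 * (‖ψ‖ + 1)) := by positivity
  obtain ⟨g, hg, hgint⟩ := hw.exists_boundedContinuous_integral_sub_le hδ
  refine ⟨fun π => ∫ p, g p.1 * ψ p.2 ∂(π : Measure (X × Y)), ?_, fun π hπ => hu ?_⟩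
  · exact (ProbabilityMeasure.continuous_integral_boundedContinuousFunction
      ((g.compContinuous ⟨Prod.fst, continuous_fst⟩) *
        (ψ.compContinuous ⟨Prod.snd, continuous_snd⟩))).continuousOn
  · have hfst : Measure.map Prod.fst (π : Measure (X × Y)) = μ := hπ
    have hI : ∀ {k : X → ℝ}, Integrable k μ →
        Integrable (fun p : X × Y => k p.1) (π : Measure (X × Y)) := fun {k} hk => by
      rw [← hfst] at hk
      exact hk.comp_measurable measurable_fst
    have hψm : AEStronglyMeasurable (fun p : X × Y => ψ p.2) (π : Measure (X × Y)) :=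
      (ψ.continuous.measurable.comp measurable_snd).aestronglyMeasurable
    have hb : ∀ᵐ p ∂(π : Measure (X × Y)), ‖ψ p.2‖ ≤ ‖ψ‖ :=
      Filter.Eventually.of_forall fun p => ψ.norm_coe_le_norm p.2
    have h1 := (hI hw).mul_bdd hψm hb
    have h2 := (hI hgint).mul_bdd hψm hb
    rw [Real.dist_eq, ← integral_sub h1 h2, ← Real.norm_eq_abs]
    calc ‖∫ p, (w p.1 * ψ p.2 - g p.1 * ψ p.2) ∂(π : Measure (X × Y))‖
        ≤ ∫ p, ‖w p.1 - g p.1‖ * ‖ψ‖ ∂(π : Measure (X × Y)) := by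
          refine norm_integral_le_of_norm_le ((hI (hw.sub hgint)).norm.mul_const _)
            (Filter.Eventually.of_forall fun p => ?_)
          rw [← sub_mul, norm_mul]
          gcongr
          exact ψ.norm_coe_le_norm p.2
      _ = (∫ x, ‖w x - g x‖ ∂μ) * ‖ψ‖ := by
          rw [integral_mul_const, ← hfst, integral_map measurable_fst.aemeasurable]
          rw [hfst]
          exact (hw.sub hgint).norm.aestronglyMeasurable
      _ ≤ ε / (2 * (‖ψ‖ + 1)) * ‖ψ‖ := by gcongr
      _ < ε := by
          rw [div_mul_eq_mul_div, div_lt_iff₀ (by positivity)]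
          nlinarith [norm_nonneg ψ]

theorem isTightMeasureSet_of_fst_snd {μ : Measure X} {ν : Measure Y} (hμ : IsTightMeasureSet {μ})
    (hν : IsTightMeasureSet {ν}) (S : Set (Measure (X × Y)))
    [T2Space X] [T2Space Y] [OpensMeasurableSpace X] [OpensMeasurableSpace Y]
    (hS : ∀ π ∈ S, π.fst = μ ∧ π.snd = ν) : IsTightMeasureSet S := by
  rw [isTightMeasureSet_iff_exists_isCompact_measure_compl_le] at hμ hν ⊢
  intro ε hε
  obtain ⟨K, hK, hμK⟩ := hμ (ε / 2) (ENNReal.half_pos hε.ne')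
  obtain ⟨L, hL, hνL⟩ := hν (ε / 2) (ENNReal.half_pos hε.ne')
  refine ⟨K ×ˢ L, hK.prod hL, fun π hπ => ?_⟩
  calc π (K ×ˢ L)ᶜ ≤ π (Prod.fst ⁻¹' Kᶜ) + π (Prod.snd ⁻¹' Lᶜ) := by
        refine (measure_mono ?_).trans (measure_union_le _ _)
        intro p hp
        by_cases h : p.1 ∈ K
        · exact Or.inr fun h' => hp ⟨h, h'⟩
        · exact Or.inl h
    _ = μ Kᶜ + ν Lᶜ := by
        rw [← (hS π hπ).1, ← (hS π hπ).2, Measure.fst_apply hK.measurableSet.compl,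
          Measure.snd_apply hL.measurableSet.compl]
    _ ≤ ε / 2 + ε / 2 := add_le_add (hμK μ rfl) (hνL ν rfl)
    _ = ε := ENNReal.add_halves ε

end Existence

section ExistencePolish

open BoundedContinuousFunction

variable {X Y : Type*} [TopologicalSpace X] [PolishSpace X] [TopologicalSpace Y] [PolishSpace Y]
  [MeasurableSpace X] [BorelSpace X] [MeasurableSpace Y] [BorelSpace Y] [Nonempty Y]
  {n : ℕ} {μs : Fin n → Measure X} [∀ i, IsProbabilityMeasure (μs i)] {ν : Measure Y}
  [IsProbabilityMeasure ν] {f : Fin n → SimpleFunc X ℝ≥0}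

/-- The constraints are the two marginals together with the equations `∫ fᵢ(x) ψ(y) dπ = ∫ ψ dν` for
all bounded continuous `ψ`, each of them closed. -/
theorem isClosed_simultaneousPlans (hn : 0 < n)
    (hf : ∀ i, (fun x => (f i x : ℝ≥0∞)) =ᵐ[meanMeasure μs] (μs i).rnDeriv (meanMeasure μs)) :
    IsClosed (simultaneousPlans μs ν) := by
  have hμ := isProbabilityMeasure_meanMeasure hn μs
  have hfst : IsClosed {π : ProbabilityMeasure (X × Y) |
      (π : Measure (X × Y)).fst = meanMeasure μs} := by
    let μ' : ProbabilityMeasure X := ⟨meanMeasure μs, hμ⟩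
    have h := isClosed_singleton (x := μ') |>.preimage
      (ProbabilityMeasure.continuous_map (Ω := X × Y) continuous_fst)
    convert h using 1
    ext π
    exact (Subtype.ext_iff (a1 := π.map continuous_fst.measurable.aemeasurable) (a2 := μ')).symm
  have hsnd : IsClosed {π : ProbabilityMeasure (X × Y) | (π : Measure (X × Y)).snd = ν} := by
    let ν' : ProbabilityMeasure Y := ⟨ν, inferInstance⟩
    have h := isClosed_singleton (x := ν') |>.preimage
      (ProbabilityMeasure.continuous_map (Ω := X × Y) continuous_snd)
    convert h using 1
    ext π
    exact (Subtype.ext_iff (a1 := π.map continuous_snd.measurable.aemeasurable) (a2 := ν')).symm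
  have hdens : ∀ i, ∀ ψ : Y →ᵇ ℝ, IsClosed ({π : ProbabilityMeasure (X × Y) |
      (π : Measure (X × Y)).fst = meanMeasure μs} ∩
      (fun π : ProbabilityMeasure (X × Y) => ∫ p, (f i p.1 : ℝ) * ψ p.2 ∂(π : Measure (X × Y)))
        ⁻¹' {∫ y, ψ y ∂ν}) := fun i ψ => by
    have hint : Integrable (fun x => (f i x : ℝ)) (meanMeasure μs) :=
      ((f i).map ((↑) : ℝ≥0 → ℝ)).integrable_of_isFiniteMeasure
    exact (continuousOn_integral_mul hint ψ).preimage_isClosed_of_isClosed hfst isClosed_singleton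
  have hfinite : ∀ (π : ProbabilityMeasure (X × Y)) i,
      IsFiniteMeasure ((π : Measure (X × Y)).withDensity fun p => (f i p.1 : ℝ≥0∞)) := fun π i => by
    obtain ⟨M, hM⟩ := (f i).finite_range.bddAbove
    refine isFiniteMeasure_withDensity (ne_top_of_le_ne_top (b := (M : ℝ≥0∞)) ENNReal.coe_ne_top ?_)
    calc ∫⁻ p, (f i p.1 : ℝ≥0∞) ∂(π : Measure (X × Y)) ≤ ∫⁻ _, (M : ℝ≥0∞) ∂(π : Measure (X × Y)) :=
          lintegral_mono fun p => ENNReal.coe_le_coe.2 (hM ⟨p.1, rfl⟩)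
      _ = M := by simp
  convert hsnd.inter (hfst.inter (isClosed_iInter fun i => isClosed_iInter (hdens i))) using 1
  ext π
  rw [mem_simultaneousPlans_iff hn (w := fun i x => (f i x : ℝ≥0∞))
    (fun i => (f i).measurable.coe_nnreal_ennreal) hf]
  simp only [Set.mem_inter_iff, Set.mem_iInter, Set.mem_ofPred_eq, Set.mem_preimage,
    Set.mem_singleton_iff]
  constructor
  · rintro ⟨h1, h2, h3⟩
    refine ⟨h2, h1, fun i ψ => ⟨h1, ?_⟩⟩
    rw [← integral_snd_withDensity _ (f i).measurable, h3 i]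
  · rintro ⟨h2, h1, h3⟩
    refine ⟨h1, h2, fun i => ?_⟩
    have := hfinite π i
    refine ext_of_forall_integral_eq_of_IsFiniteMeasure fun ψ => ?_
    rw [integral_snd_withDensity _ (f i).measurable]
    exact (h3 i ψ).2

theorem isCompact_simultaneousPlans (hn : 0 < n)
    (hf : ∀ i, (fun x => (f i x : ℝ≥0∞)) =ᵐ[meanMeasure μs] (μs i).rnDeriv (meanMeasure μs)) :
    IsCompact (simultaneousPlans μs ν) := by
  have hμ := isProbabilityMeasure_meanMeasure hn μs
  let _ := TopologicalSpace.upgradeIsCompletelyMetrizable X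
  let _ := TopologicalSpace.upgradeIsCompletelyMetrizable Y
  rw [← (isClosed_simultaneousPlans hn hf).closure_eq]
  refine isCompact_closure_of_isTightMeasureSet
    (isTightMeasureSet_of_fst_snd (μ := meanMeasure μs) (ν := ν)
      isTightMeasureSet_singleton isTightMeasureSet_singleton _ ?_)
  rintro _ ⟨π, hπ, rfl⟩
  exact ⟨hπ.1, hπ.2.1⟩

theorem exists_isKantorovichSolution (hn : 0 < n)
    (hf : ∀ i, (fun x => (f i x : ℝ≥0∞)) =ᵐ[meanMeasure μs] (μs i).rnDeriv (meanMeasure μs))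
    {c : X → Y → ℝ≥0} (hc : Continuous fun p : X × Y => c p.1 p.2)
    (hne : (simultaneousPlans μs ν).Nonempty) :
    ∃ π, IsKantorovichSolution (fun x y => (c x y : ℝ≥0∞)) μs ν π := by
  obtain ⟨π, hπ, hmin⟩ := LowerSemicontinuousOn.exists_isMinOn hne
    (isCompact_simultaneousPlans hn hf)
    ((lowerSemicontinuous_lintegral_nnreal hc).lowerSemicontinuousOn _)
  exact ⟨π, hπ, fun π' hπ' => hmin hπ'⟩

end ExistencePolish

/-! ### Plans carried by graphs and the Monge problem -/

section Monge

theorem mapCost_eq_natCast_mul {X Y : Type*} [MeasurableSpace X] {n : ℕ} {μs : Fin n → Measure X}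
    (hn : 0 < n) (c : X → Y → ℝ≥0∞) (T : X → Y) :
    mapCost c μs T = n * ∫⁻ x, c x (T x) ∂(meanMeasure μs) := by
  rw [← smul_eq_mul, ← lintegral_smul_measure, natCast_smul_meanMeasure hn,
    lintegral_finsetSum_measure, mapCost]

variable {X Y : Type*} [MeasurableSpace X] [MeasurableSpace Y]

theorem inv_two_smul_add_inv_two_smul (m : Measure X) :
    (2⁻¹ : ℝ≥0∞) • m + (2⁻¹ : ℝ≥0∞) • m = m := by
  rw [← add_smul, ENNReal.inv_two_add_inv_two, one_smul]

theorem eq_map_of_ae_eq {π : Measure (X × Y)} {T : X → Y} (hT : Measurable T)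
    (h : ∀ᵐ p ∂π, p.2 = T p.1) : π = π.fst.map fun x => (x, T x) := by
  rw [Measure.fst, Measure.map_map (by fun_prop) measurable_fst]
  conv_lhs => rw [← Measure.map_id (μ := π)]
  exact Measure.map_congr (h.mono fun p hp => Prod.ext rfl hp)

/-- The plan `(id, T)_# μ` carried by the graph of `T`. -/
noncomputable def graphPlan (μ : Measure X) [IsProbabilityMeasure μ] {T : X → Y} (hT : Measurable T) :
    ProbabilityMeasure (X × Y) :=
  ⟨μ.map fun x => (x, T x), Measure.isProbabilityMeasure_map (by fun_prop)⟩

theorem coe_graphPlan (μ : Measure X) [IsProbabilityMeasure μ] {T : X → Y} (hT : Measurable T) :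
    (graphPlan μ hT : Measure (X × Y)) = μ.map fun x => (x, T x) := rfl

theorem planCost_graphPlan {c : X → Y → ℝ≥0∞} (hc : Measurable fun p : X × Y => c p.1 p.2)
    (μ : Measure X) [IsProbabilityMeasure μ] {T : X → Y} (hT : Measurable T) :
    planCost c (graphPlan μ hT) = ∫⁻ x, c x (T x) ∂μ := by
  rw [planCost, coe_graphPlan, lintegral_map hc (by fun_prop)]

variable {n : ℕ} {μs : Fin n → Measure X} {ν : Measure Y}

variable [∀ i, IsProbabilityMeasure (μs i)] [StandardBorelSpace Y] [Nonempty Y]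
  {w : Fin n → X → ℝ≥0∞} {c : X → Y → ℝ≥0∞}

/-- The constraint for the densities contains the one for the second marginal, because `μ` is the
mean of the `μᵢ`. -/
theorem graphPlan_mem_simultaneousPlans_iff (hn : 0 < n) (hwm : ∀ i, Measurable (w i))
    (hw : ∀ i, w i =ᵐ[meanMeasure μs] (μs i).rnDeriv (meanMeasure μs))
    [IsProbabilityMeasure (meanMeasure μs)] {T : X → Y} (hT : Measurable T) :
    graphPlan (meanMeasure μs) hT ∈ simultaneousPlans μs ν ↔ T ∈ simultaneousMaps μs ν := by
  rw [mem_simultaneousPlans_iff hn hwm hw]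
  have hdens : ∀ i, ((graphPlan (meanMeasure μs) hT : Measure (X × Y)).withDensity
      fun p => w i p.1).snd = (μs i).map T := fun i => by
    rw [coe_graphPlan, snd_withDensity_map_graph hT (hwm i), withDensity_meanMeasure_eq hn (hw i)]
  simp only [hdens]
  refine ⟨fun h => ⟨hT, h.2.2⟩, fun h => ⟨?_, ?_, h.2⟩⟩
  · rw [coe_graphPlan, Measure.fst_map_prodMk hT]
    exact Measure.map_id
  · rw [coe_graphPlan, Measure.snd_map_prodMk (X := fun x => x) measurable_id]
    have hn' : (n : ℝ≥0∞) ≠ 0 := by exact_mod_cast hn.ne'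
    ext B hB
    have hB' : ∀ i, μs i (T ⁻¹' B) = ν B := fun i => by rw [← h.2 i, Measure.map_apply hT hB]
    rw [Measure.map_apply hT hB]
    simp [meanMeasure, Measure.finsetSum_apply, hB', ← mul_assoc,
      ENNReal.inv_mul_cancel hn' (ENNReal.natCast_ne_top n)]

/-- An optimal plan carried by the graph of `T` makes `T` optimal, since every competitor of `T`
yields a plan whose cost is the Monge cost divided by `n`. -/
theorem IsKantorovichSolution.isMongeSolution (hn : 0 < n) (hwm : ∀ i, Measurable (w i))
    (hw : ∀ i, w i =ᵐ[meanMeasure μs] (μs i).rnDeriv (meanMeasure μs))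
    (hc : Measurable fun p : X × Y => c p.1 p.2)
    {π : ProbabilityMeasure (X × Y)} (hπ : IsKantorovichSolution c μs ν π)
    {T : X → Y} (hT : Measurable T) (h : ∀ᵐ p ∂(π : Measure (X × Y)), p.2 = T p.1) :
    IsMongeSolution c μs ν T := by
  have hμ := isProbabilityMeasure_meanMeasure hn μs
  have hgraph : π = graphPlan (meanMeasure μs) hT :=
    Subtype.ext ((eq_map_of_ae_eq hT h).trans (by rw [hπ.1.1]; rfl))
  subst hgraph
  refine ⟨(graphPlan_mem_simultaneousPlans_iff hn hwm hw hT).1 hπ.1, fun T' hT' => ?_⟩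
  have hle := hπ.2 _ ((graphPlan_mem_simultaneousPlans_iff hn hwm hw hT'.1).2 hT')
  rw [planCost_graphPlan hc, planCost_graphPlan hc] at hle
  rw [mapCost_eq_natCast_mul hn, mapCost_eq_natCast_mul hn]
  gcongr

/-- As soon as some optimal plan is carried by a graph, the Monge and the Kantorovich problems have
the same value, so that optimal maps give optimal plans. -/
theorem IsMongeSolution.isKantorovichSolution_graphPlan (hn : 0 < n)
    (hwm : ∀ i, Measurable (w i))
    (hw : ∀ i, w i =ᵐ[meanMeasure μs] (μs i).rnDeriv (meanMeasure μs))
    [IsProbabilityMeasure (meanMeasure μs)]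
    (hc : Measurable fun p : X × Y => c p.1 p.2)
    {π : ProbabilityMeasure (X × Y)} (hπ : IsKantorovichSolution c μs ν π)
    {S : X → Y} (hS : Measurable S) (h : ∀ᵐ p ∂(π : Measure (X × Y)), p.2 = S p.1)
    {T : X → Y} (hT : IsMongeSolution c μs ν T) :
    IsKantorovichSolution c μs ν (graphPlan (meanMeasure μs) hT.1.1) := by
  have hSmonge := hπ.isMongeSolution hn hwm hw hc hS h
  have hgraph : π = graphPlan (meanMeasure μs) hS :=
    Subtype.ext ((eq_map_of_ae_eq hS h).trans (by rw [hπ.1.1]; rfl))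
  subst hgraph
  refine ⟨(graphPlan_mem_simultaneousPlans_iff hn hwm hw hT.1.1).2 hT.1, fun π' hπ' => ?_⟩
  refine le_trans ?_ (hπ.2 π' hπ')
  have hle := hT.2 S hSmonge.1
  rw [mapCost_eq_natCast_mul hn, mapCost_eq_natCast_mul hn] at hle
  rw [planCost_graphPlan hc, planCost_graphPlan hc]
  exact (ENNReal.mul_le_mul_iff_right (by exact_mod_cast hn.ne') (ENNReal.natCast_ne_top n)).1 hle

/-- The plans are convex and the cost is linear, so the mean of two optimal plans is optimal. -/
theorem IsKantorovichSolution.exists_mean (hn : 0 < n) (hwm : ∀ i, Measurable (w i))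
    (hw : ∀ i, w i =ᵐ[meanMeasure μs] (μs i).rnDeriv (meanMeasure μs))
    {π π' : ProbabilityMeasure (X × Y)} (hπ : IsKantorovichSolution c μs ν π)
    (hπ' : IsKantorovichSolution c μs ν π') :
    ∃ σ : ProbabilityMeasure (X × Y), IsKantorovichSolution c μs ν σ ∧
      (π : Measure (X × Y)) ≪ σ ∧ (π' : Measure (X × Y)) ≪ σ := by
  have half : ∀ a : ℝ≥0∞, (2⁻¹ : ℝ≥0∞) * a + 2⁻¹ * a = a := fun a => by
    rw [← add_mul, ENNReal.inv_two_add_inv_two, one_mul]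
  let m : Measure (X × Y) := (2⁻¹ : ℝ≥0∞) • (π : Measure (X × Y)) + (2⁻¹ : ℝ≥0∞) • π'
  have hm : IsProbabilityMeasure m := ⟨by simp [m, ENNReal.inv_two_add_inv_two]⟩
  have h2 : (2⁻¹ : ℝ≥0∞) ≠ 0 := by simp
  refine ⟨⟨m, hm⟩, ⟨?_, fun τ hτ => ?_⟩, ?_, ?_⟩
  · obtain ⟨a1, a2, a3⟩ := (mem_simultaneousPlans_iff hn hwm hw).1 hπ.1
    obtain ⟨b1, b2, b3⟩ := (mem_simultaneousPlans_iff hn hwm hw).1 hπ'.1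
    rw [Measure.fst] at a1 b1
    rw [Measure.snd] at a2 b2
    refine (mem_simultaneousPlans_iff hn hwm hw).2 ⟨?_, ?_, fun i => ?_⟩
    · change m.fst = _
      rw [Measure.fst, Measure.map_add _ _ measurable_fst, Measure.map_smul, Measure.map_smul,
        a1, b1, inv_two_smul_add_inv_two_smul]
    · change m.snd = _
      rw [Measure.snd, Measure.map_add _ _ measurable_snd, Measure.map_smul, Measure.map_smul,
        a2, b2, inv_two_smul_add_inv_two_smul]
    · have ha := a3 i
      have hb := b3 i
      rw [Measure.snd] at ha hb
      change (m.withDensity _).snd = _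
      rw [withDensity_add_measure, withDensity_smul_measure, withDensity_smul_measure, Measure.snd,
        Measure.map_add _ _ measurable_snd, Measure.map_smul, Measure.map_smul, ha, hb, inv_two_smul_add_inv_two_smul]
  · have hcost : planCost c ⟨m, hm⟩ = 2⁻¹ * planCost c π + 2⁻¹ * planCost c π' := by
      change ∫⁻ p, c p.1 p.2 ∂m = _
      rw [lintegral_add_measure, lintegral_smul_measure, lintegral_smul_measure]
      rfl
    rw [hcost, ← half (planCost c τ)]
    gcongr
    · exact hπ.2 τ hτ
    · exact hπ'.2 τ hτ
  · exact (Measure.absolutelyContinuous_smul h2).trans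
      (Measure.absolutelyContinuous_of_le (Measure.le_add_right le_rfl))
  · exact (Measure.absolutelyContinuous_smul h2).trans
      (Measure.absolutelyContinuous_of_le (Measure.le_add_left le_rfl))

/-- If every optimal plan is carried by a graph, then the graph carrying the mean of two optimal
plans carries both of them, and they coincide. -/
theorem IsKantorovichSolution.unique_of_forall_graph (hn : 0 < n) (hwm : ∀ i, Measurable (w i))
    (hw : ∀ i, w i =ᵐ[meanMeasure μs] (μs i).rnDeriv (meanMeasure μs))
    (hgraph : ∀ π, IsKantorovichSolution c μs ν π →
      ∃ T : X → Y, Measurable T ∧ ∀ᵐ p ∂(π : Measure (X × Y)), p.2 = T p.1)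
    {π π' : ProbabilityMeasure (X × Y)} (hπ : IsKantorovichSolution c μs ν π)
    (hπ' : IsKantorovichSolution c μs ν π') : π = π' := by
  obtain ⟨σ, hσ, hac, hac'⟩ := hπ.exists_mean hn hwm hw hπ'
  obtain ⟨T, hT, hTσ⟩ := hgraph σ hσ
  refine Subtype.ext ?_
  have h := eq_map_of_ae_eq hT (hac.ae_le hTσ)
  have h' := eq_map_of_ae_eq hT (hac'.ae_le hTσ)
  rw [hπ.1.1] at h
  rw [hπ'.1.1] at h'
  exact h.trans h'.symm

theorem ae_eq_of_map_graph_eq {Y : Type*} [MeasurableSpace Y] [MeasurableEq Y] {μ : Measure X}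
    {T T' : X → Y} (hT : Measurable T)
    (hT' : Measurable T') (h : (μ.map fun x => (x, T x)) = μ.map fun x => (x, T' x)) :
    T =ᵐ[μ] T' := by
  have hmeas : MeasurableSet {p : X × Y | p.2 = T p.1} :=
    measurableSet_eq_fun measurable_snd (hT.comp measurable_fst)
  have h1 : ∀ᵐ p ∂(μ.map fun x => (x, T x)), p.2 = T p.1 :=
    (ae_map_iff (by fun_prop) hmeas).2 (Filter.Eventually.of_forall fun _ => rfl)
  rw [h, ae_map_iff (by fun_prop) hmeas] at h1
  exact h1.mono fun x hx => hx.symm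

theorem ae_of_rnDeriv_ne_zero {μ ρ : Measure X} [SigmaFinite μ] [SigmaFinite ρ] {p : X → Prop}
    (h : ∀ᵐ x ∂μ, p x) : ∀ᵐ x ∂ρ, μ.rnDeriv ρ x ≠ 0 → p x := by
  have h1 : ∀ᵐ x ∂(ρ.withDensity (μ.rnDeriv ρ)), p x :=
    (Measure.absolutelyContinuous_of_le (Measure.withDensity_rnDeriv_le μ ρ)).ae_le h
  exact (ae_withDensity_iff (Measure.measurable_rnDeriv μ ρ)).1 h1

end Monge

theorem quadraticCost_eq_coe {E : Type*} [NormedAddCommGroup E] :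
    (quadraticCost : E → E → ℝ≥0∞) =
      fun x y => ((‖x - y‖₊ ^ 2 : ℝ≥0) : ℝ≥0∞) := by
  funext x y
  rw [quadraticCost, ENNReal.ofReal]
  congr 1
  ext
  simp

end SimultaneousTransport

theorem mainTheorem3 (d n : ℕ) (hn : 0 < n)
    (μs : Fin n → Measure (EuclideanSpace ℝ (Fin d))) [∀ i, IsProbabilityMeasure (μs i)]
    (ν : Measure (EuclideanSpace ℝ (Fin d))) [IsProbabilityMeasure ν]
    (hac : ∀ i, μs i ≪ volume)
    (f : Fin n → SimpleFunc (EuclideanSpace ℝ (Fin d)) ℝ≥0)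
    (hf : ∀ i, (fun x => (f i x : ℝ≥0∞)) =ᵐ[SimultaneousTransport.meanMeasure μs]
      (μs i).rnDeriv (SimultaneousTransport.meanMeasure μs))
    (hcont : ∀ i, ∀ᵐ x ∂(volume : Measure (EuclideanSpace ℝ (Fin d))), ContinuousAt (f i) x)
    (hfin : ∃ π ∈ SimultaneousTransport.simultaneousPlans μs ν,
      SimultaneousTransport.planCost SimultaneousTransport.quadraticCost π < ∞) :
    (∃ π, SimultaneousTransport.IsKantorovichSolution
      SimultaneousTransport.quadraticCost μs ν π) ∧
    (∀ π, SimultaneousTransport.IsKantorovichSolution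
        SimultaneousTransport.quadraticCost μs ν π →
      ∃ T, SimultaneousTransport.ConcentratedOnGraph π T ∧
        SimultaneousTransport.IsMongeSolution SimultaneousTransport.quadraticCost μs ν T) ∧
    (∀ π π', SimultaneousTransport.IsKantorovichSolution
        SimultaneousTransport.quadraticCost μs ν π →
      SimultaneousTransport.IsKantorovichSolution
        SimultaneousTransport.quadraticCost μs ν π' → π = π') ∧
    (∀ T T', SimultaneousTransport.IsMongeSolution
        SimultaneousTransport.quadraticCost μs ν T →
      SimultaneousTransport.IsMongeSolution
        SimultaneousTransport.quadraticCost μs ν T' →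
      ∀ᵐ x ∂(volume : Measure (EuclideanSpace ℝ (Fin d))),
        (SimultaneousTransport.meanMeasure μs).rnDeriv volume x ≠ 0 → T x = T' x) := by
  have hμ := SimultaneousTransport.isProbabilityMeasure_meanMeasure hn μs
  have hc : Measurable fun p : EuclideanSpace ℝ (Fin d) × EuclideanSpace ℝ (Fin d) =>
      SimultaneousTransport.quadraticCost p.1 p.2 :=
    SimultaneousTransport.measurable_quadraticCost
  have hwm : ∀ i, Measurable fun x => (f i x : ℝ≥0∞) := fun i =>
    (f i).measurable.coe_nnreal_ennreal
  obtain ⟨π₀, hπ₀, hfin₀⟩ := hfin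
  have hgraph : ∀ π, SimultaneousTransport.IsKantorovichSolution
      SimultaneousTransport.quadraticCost μs ν π →
      ∃ T : EuclideanSpace ℝ (Fin d) → EuclideanSpace ℝ (Fin d), Measurable T ∧
        ∀ᵐ p ∂(π : Measure (EuclideanSpace ℝ (Fin d) × EuclideanSpace ℝ (Fin d))), p.2 = T p.1 :=
    fun π hπ => hπ.exists_graph hn hac hf ((hπ.2 π₀ hπ₀).trans_lt hfin₀).ne
  have hunique : ∀ π π', SimultaneousTransport.IsKantorovichSolution
        SimultaneousTransport.quadraticCost μs ν π →
      SimultaneousTransport.IsKantorovichSolution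
        SimultaneousTransport.quadraticCost μs ν π' → π = π' := fun π π' hπ hπ' =>
    SimultaneousTransport.IsKantorovichSolution.unique_of_forall_graph hn
      (w := fun i x => (f i x : ℝ≥0∞)) hwm hf hgraph hπ hπ'
  have hexists : ∃ π, SimultaneousTransport.IsKantorovichSolution
      SimultaneousTransport.quadraticCost μs ν π := by
    rw [SimultaneousTransport.quadraticCost_eq_coe]
    exact SimultaneousTransport.exists_isKantorovichSolution hn hf
      (c := fun x y => ‖x - y‖₊ ^ 2) (by fun_prop) ⟨π₀, hπ₀⟩
  refine ⟨hexists, fun π hπ => ?_, hunique, fun T T' hT hT' => ?_⟩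
  · obtain ⟨T, hTm, hT⟩ := hgraph π hπ
    exact ⟨T, hT, hπ.isMongeSolution hn (w := fun i x => (f i x : ℝ≥0∞)) hwm hf hc hTm hT⟩
  · obtain ⟨π, hπ⟩ := hexists
    obtain ⟨S, hSm, hS⟩ := hgraph π hπ
    have h := hT.isKantorovichSolution_graphPlan hn (w := fun i x => (f i x : ℝ≥0∞)) hwm hf hc
      hπ hSm hS
    have h' := hT'.isKantorovichSolution_graphPlan hn (w := fun i x => (f i x : ℝ≥0∞)) hwm hf hc
      hπ hSm hS
    exact SimultaneousTransport.ae_of_rnDeriv_ne_zero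
      (SimultaneousTransport.ae_eq_of_map_graph_eq hT.1.1 hT'.1.1
        (congrArg Subtype.val (hunique _ _ h h')))
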